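/- Let $d\ge 2$ be an integer and $\mathbb Z_d=\mathbb Z/d\mathbb Z$. For $f,g:\mathbb Z_d\to\mathbb C$ let $$\hat g(l)=\sum_{j\in\mathbb Z_d} g(j)\,e^{-2\pi i jl/d},\qquad V_gf(k,l)=\sum_{j\in\mathbb Z_d} f(j)\,\overline{g(j-k)}\,e^{-2\pi i jl/d}\qquad(k,l\in\mathbb Z_d)$$ be the discrete Fourier transform of $g$ and the short-time Fourier transform of $f$ with window $g$, and let $\operatorname{supp}(V_gg)=\{(k,l)\in\mathbb Z_d^2 : V_gg(k,l)\neq 0\}$. A signal $f$ is called phase retrievable with respect to a window $g$ if every $\tilde f:\mathbb Z_d\to\mathbb C$ with $|V_g\tilde f|=|V_gf|$ on $\mathbb Z_d^2$ is of the form $\tilde f=\gamma f$ for some $\gamma\in\mathbb C$ with $|\gamma|=1$. Let $m^\ast=\frac{d-1}{4}$ if $d$ is prime and $m^\ast=\frac{d-1}{3}$ otherwise. Let $m>m^\ast$ be an integer, and let $g:\mathbb Z_d\to\mathbb C$ be such that $\{-m,\dots,m\}\times\mathbb Z_d\subseteq\operatorname{supp}(V_gg)$, where $\{-m,\dots,m\}$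 denotes the set of residue classes modulo $d$ of the integers from $-m$ to $m$. Then the pair $(g,\hat g)$ does strong two-window phase retrieval, that is, every $f:\mathbb Z_d\to\mathbb C$ is phase retrievable with respect to at least one of the windows $g$ and $\hat g$. -/

import Mathlib

namespace FiniteSTFT

/-- The short-time Fourier transform on `ZMod d`,
`V_g f (k, l) = ∑ j, f j * conj (g (j - k)) * exp (-2 π i j l / d)`.
Here `ZMod.stdAddChar a = exp (2 π i a / d)`, and the Fourier transform with the same
(unnormalised) convention is Mathlib's `ZMod.dft`. -/
noncomputable def stft {d : ℕ} [NeZero d] (g f : ZMod d → ℂ) (p : ZMod d × ZMod d) : ℂ :=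
  ∑ j : ZMod d, f j * starRingEnd ℂ (g (j - p.1)) * ZMod.stdAddChar (-(j * p.2))

/-- `f` is determined by `|V_g f|` up to a global phase, among all signals. -/
def PhaseRetrievable {d : ℕ} [NeZero d] (g f : ZMod d → ℂ) : Prop :=
  ∀ f' : ZMod d → ℂ, (∀ p : ZMod d × ZMod d, ‖stft g f' p‖ = ‖stft g f p‖) →
    ∃ γ : ℂ, ‖γ‖ = 1 ∧ f' = γ • f

/-- Every signal is phase retrievable with respect to at least one of the two windows. -/
def StrongTwoWindowPhaseRetrieval {d : ℕ} [NeZero d] (g₁ g₂ : ZMod d → ℂ) : Prop :=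
  ∀ f : ZMod d → ℂ, PhaseRetrievable g₁ f ∨ PhaseRetrievable g₂ f

/-- The range `{a, …, b}` of integers, read modulo `d`. -/
def indexRange (d : ℕ) (a b : ℤ) : Set (ZMod d) :=
  (fun j : ℤ => (j : ZMod d)) '' Set.Icc a b

/-- The threshold `m*`: `(d - 1) / 4` if `d` is prime and `(d - 1) / 3` otherwise. -/
noncomputable def mStar (d : ℕ) : ℝ :=
  if d.Prime then ((d : ℝ) - 1) / 4 else ((d : ℝ) - 1) / 3

end FiniteSTFT

open ZMod
open scoped ComplexConjugate

namespace FiniteSTFT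

variable {d : ℕ} [NeZero d]

/-! The double Fourier transform of `|V_g f|²` is, up to a factor and coordinates, `V_f f * conj
(V_g g)` (`sum_stft_mul_conj`). So the magnitudes fix `V_f f` on the strip where `V_g g ≠ 0`, hence
the products `f j * conj (f (j - k))` for `|k| ≤ m`. Passing to Fourier transforms rotates this
picture by a quarter turn (`stft_dft_self`), so the window `ĝ` fixes the same products for `f̂`.

If `f` fails for both windows, `f` and `f̂` each vanish on two disjoint runs of `m` points
(`exists_gap_of_forall_ne_smul`). When `d ≤ 3m`, `f` has at most `m` nonzero values, and a
Vandermonde argument with one run of zeros of `f̂` gives `f = 0`. When `d` is prime and `d ≤ 4m`,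
the two supports have total size at most `2d - 4m ≤ d`, against the uncertainty principle that
follows from Chebotarev's theorem. -/

theorem conj_stdAddChar (x : ZMod d) :
    conj (ZMod.stdAddChar x : ℂ) = ZMod.stdAddChar (-x) :=
  (AddChar.map_neg_eq_conj _ x).symm

theorem stdAddChar_ne_zero (x : ZMod d) : (ZMod.stdAddChar x : ℂ) ≠ 0 := fun h => by
  have h1 := AddChar.norm_apply (ZMod.stdAddChar (N := d)) x
  rw [h, norm_zero] at h1
  exact zero_ne_one h1

theorem sum_stdAddChar_mul (x : ZMod d) :
    ∑ l : ZMod d, (ZMod.stdAddChar (l * x) : ℂ) = if x = 0 then (d : ℂ) else 0 := by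
  simpa using AddChar.sum_mulShift (R := ZMod d) x (ZMod.isPrimitive_stdAddChar d)

theorem sum_dft_mul_conj_dft (u v : ZMod d → ℂ) (t : ZMod d) :
    ∑ l, 𝓕 u l * conj (𝓕 v l) * ZMod.stdAddChar (l * t) =
      d * ∑ j, u j * conj (v (j - t)) := by
  calc ∑ l, 𝓕 u l * conj (𝓕 v l) * ZMod.stdAddChar (l * t)
      = ∑ l, ∑ j, ∑ i, u j * conj (v i) * ZMod.stdAddChar (l * (i - (j - t))) := by
        refine Finset.sum_congr rfl fun l _ => ?_
        simp only [dft_apply, smul_eq_mul, map_sum, map_mul, conj_stdAddChar, neg_neg]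
        rw [Finset.sum_mul_sum, Finset.sum_mul]
        refine Finset.sum_congr rfl fun j _ => ?_
        rw [Finset.sum_mul]
        refine Finset.sum_congr rfl fun i _ => ?_
        rw [show l * (i - (j - t)) = -(j * l) + i * l + l * t by ring,
          AddChar.map_add_eq_mul, AddChar.map_add_eq_mul]
        ring
    _ = ∑ j, ∑ i, u j * conj (v i) * ∑ l, ZMod.stdAddChar (l * (i - (j - t))) := by
        rw [Finset.sum_comm]
        refine Finset.sum_congr rfl fun j _ => ?_
        rw [Finset.sum_comm]
        simp only [Finset.mul_sum]
    _ = d * ∑ j, u j * conj (v (j - t)) := by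
        rw [Finset.mul_sum]
        refine Finset.sum_congr rfl fun j _ => ?_
        simp only [sum_stdAddChar_mul, sub_eq_zero]
        simp
        ring

theorem stft_eq_dft (g f : ZMod d → ℂ) (k l : ZMod d) :
    stft g f (k, l) = 𝓕 (fun j => f j * conj (g (j - k))) l := by
  simp [stft, dft_apply, mul_comm]

/-- Parseval removes the sum over `l`; the substitution `i = j - k` then separates the double sum
into a product. -/
theorem sum_stft_mul_conj (g f : ZMod d → ℂ) (s t : ZMod d) :
    ∑ k, (∑ l, stft g f (k, l) * conj (stft g f (k, l)) * ZMod.stdAddChar (l * t)) *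
      ZMod.stdAddChar (-(k * s)) = d * (stft f f (t, s) * conj (stft g g (t, s))) := by
  simp only [stft_eq_dft g f, sum_dft_mul_conj_dft]
  calc _ = d * ∑ j, ∑ k, f j * conj (g (j - k)) * conj (f (j - t) * conj (g (j - t - k))) *
          ZMod.stdAddChar (-(k * s)) := by
        rw [Finset.sum_comm, Finset.mul_sum]
        refine Finset.sum_congr rfl fun k _ => ?_
        rw [Finset.mul_sum, Finset.mul_sum, Finset.sum_mul]
        refine Finset.sum_congr rfl fun j _ => ?_
        ring
    _ = d * ∑ j, ∑ i, f j * conj (g i) * conj (f (j - t) * conj (g (i - t))) *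
          ZMod.stdAddChar (-((j - i) * s)) := by
        congr 1
        refine Finset.sum_congr rfl fun j _ => ?_
        rw [← (Equiv.subLeft j).sum_comp]
        refine Finset.sum_congr rfl fun i _ => ?_
        simp only [Equiv.subLeft_apply, sub_sub_cancel]
        rw [show j - t - (j - i) = i - t by ring]
    _ = _ := by
        congr 1
        simp only [stft, map_sum]
        rw [Finset.sum_mul_sum]
        refine Finset.sum_congr rfl fun j _ => Finset.sum_congr rfl fun i _ => ?_
        rw [show -((j - i) * s) = -(j * s) + i * s by ring, AddChar.map_add_eq_mul]
        simp only [map_mul, conj_stdAddChar, neg_neg, Complex.conj_conj]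
        ring

theorem stft_self_eq_of_norm_stft_eq {g f f' : ZMod d → ℂ}
    (h : ∀ p : ZMod d × ZMod d, ‖stft g f' p‖ = ‖stft g f p‖) {p : ZMod d × ZMod d}
    (hp : stft g g p ≠ 0) : stft f' f' p = stft f f p := by
  obtain ⟨t, s⟩ := p
  have key : (d : ℂ) * (stft f' f' (t, s) * conj (stft g g (t, s))) =
      d * (stft f f (t, s) * conj (stft g g (t, s))) := by
    rw [← sum_stft_mul_conj, ← sum_stft_mul_conj]
    simp only [Complex.mul_conj', h]
  have hd : (d : ℂ) ≠ 0 := Nat.cast_ne_zero.2 (NeZero.ne d)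
  exact mul_right_cancel₀ (by simpa using hp) (mul_left_cancel₀ hd key)

/-- A translate of `ĝ` is the transform of a modulation of `g`, so Parseval applies. -/
theorem stft_dft_self (g : ZMod d → ℂ) (k l : ZMod d) :
    stft (𝓕 g) (𝓕 g) (k, l) = d * ZMod.stdAddChar (-(k * l)) * stft g g (-l, k) := by
  have h : ∀ j, 𝓕 g (j - k) = 𝓕 (fun y => ZMod.stdAddChar (k * y) * g y) j := by
    intro j
    simp only [dft_apply, smul_eq_mul, ← mul_assoc, ← AddChar.map_add_eq_mul]
    refine Finset.sum_congr rfl fun y _ => ?_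
    ring_nf
  simp only [stft, h]
  have := sum_dft_mul_conj_dft g (fun y => ZMod.stdAddChar (k * y) * g y) (-l)
  simp only [mul_neg] at this
  rw [this, mul_assoc, Finset.mul_sum (a := (ZMod.stdAddChar _ : ℂ))]
  congr 1
  refine Finset.sum_congr rfl fun j _ => ?_
  rw [map_mul, conj_stdAddChar, show -(k * (j - -l)) = -(k * l) + -(j * k) by ring,
    AddChar.map_add_eq_mul]
  ring

theorem mul_conj_eq_of_stft_self_eq {f f' : ZMod d → ℂ} {k : ZMod d}
    (h : ∀ l, stft f' f' (k, l) = stft f f (k, l)) (j : ZMod d) :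
    f' j * conj (f' (j - k)) = f j * conj (f (j - k)) := by
  simp only [stft_eq_dft] at h
  exact congrFun (ZMod.dft.injective (funext h)) j

end FiniteSTFT

/-! ### Chebotarev's theorem on Fourier minors of prime order -/

section ChebotarevMinors

open Polynomial

/-- In characteristic `p`, a nonzero polynomial of degree less than `p` with at most `n` terms is
not divisible by `(X - 1) ^ n`. -/
theorem Polynomial.lt_card_support_of_pow_X_sub_one_dvd {F : Type*} [CommRing F] [IsDomain F]
    (p : ℕ) [CharP F p] (n : ℕ) {P : F[X]} (hP : P ≠ 0) (hdeg : P.natDegree < p)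
    (hdvd : (X - 1) ^ n ∣ P) : n < P.support.card := by
  induction n generalizing P with
  | zero => exact Finset.card_pos.2 (support_nonempty.2 hP)
  | succ n ih =>
    obtain ⟨a, ha⟩ := support_nonempty.2 hP
    have hap : a < p := (le_natDegree_of_mem_supp a ha).trans_lt hdeg
    -- This operator kills the term of degree `a` and costs at most one factor of `X - 1`.
    set Q : F[X] := X * derivative P - C (a : F) * P with hQ
    have hcoeff : ∀ i, Q.coeff i = ((i : F) - a) * P.coeff i := by
      intro i
      rw [hQ, coeff_sub, coeff_C_mul]
      rcases i with _ | i
      · simp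
      · rw [coeff_X_mul, coeff_derivative]
        push_cast
        ring
    have hsub : Q.support ⊆ P.support.erase a := by
      intro i hi
      rw [mem_support_iff, hcoeff] at hi
      refine Finset.mem_erase.2 ⟨?_, mem_support_iff.2 (right_ne_zero_of_mul hi)⟩
      rintro rfl
      simp at hi
    have hQdvd : (X - 1) ^ n ∣ Q := by
      refine dvd_sub (dvd_mul_of_dvd_right ?_ _)
        (dvd_mul_of_dvd_right ((pow_dvd_pow _ n.le_succ).trans hdvd) _)
      obtain ⟨R, rfl⟩ := hdvd
      rw [derivative_mul, derivative_pow]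
      refine dvd_add (dvd_mul_of_dvd_left (dvd_mul_of_dvd_left ?_ _) _)
        (dvd_mul_of_dvd_left (pow_dvd_pow _ n.le_succ) _)
      exact dvd_mul_of_dvd_right (by simp) _
    have hcard : Q.support.card ≤ P.support.card - 1 :=
      (Finset.card_le_card hsub).trans (Finset.card_erase_of_mem ha).le
    have hQ0 : Q ≠ 0 := by
      intro h0
      have hmono : P = C (P.coeff a) * X ^ a := by
        ext i
        rw [coeff_C_mul, coeff_X_pow]
        split_ifs with hi
        · simp [hi]
        · have := hcoeff i
          rw [h0, coeff_zero] at this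
          rcases mul_eq_zero.1 this.symm with h | h
          · by_contra hne
            have hip : i < p := (le_natDegree_of_ne_zero (by simpa using hne)).trans_lt hdeg
            exact hi (CharP.natCast_injOn_Iio F p hip hap (sub_eq_zero.1 h))
          · simpa using h
      have heval : P.eval 1 = 0 := by
        have h1 : (X - 1 : F[X]) ∣ P := (dvd_pow_self _ n.succ_ne_zero).trans hdvd
        obtain ⟨R, rfl⟩ := h1
        simp
      rw [hmono] at heval
      simp only [eval_mul, eval_C, eval_pow, eval_X, one_pow, mul_one] at heval
      exact mem_support_iff.1 ha heval
    have hQdeg : Q.natDegree < p := by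
      refine lt_of_le_of_lt ?_ hdeg
      exact natDegree_le_natDegree (Finset.sup_mono (hsub.trans (Finset.erase_subset _ _)))
    have := ih hQ0 hQdeg hQdvd
    omega

/-- A linear system over a Noetherian domain with a nonzero solution has one that is nonzero
modulo a given nonzero nonunit. -/
theorem exists_not_dvd_of_mulVec_eq_zero {R ι κ : Type*} [CommRing R] [IsDomain R]
    [IsNoetherianRing R] [Fintype ι] {π : R} (hπ : ¬ IsUnit π) (hπ0 : π ≠ 0)
    (M : Matrix κ ι R) {v : ι → R} (hv : v ≠ 0) (hMv : M.mulVec v = 0) :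
    ∃ w : ι → R, (∃ i, ¬ π ∣ w i) ∧ M.mulVec w = 0 := by
  obtain ⟨i, hi⟩ := Function.ne_iff.1 hv
  have hfin : ∃ n, ¬ π ^ n ∣ v i := by
    obtain ⟨n, hn⟩ := FiniteMultiplicity.of_not_isUnit hπ hi
    exact ⟨n + 1, hn⟩
  obtain ⟨n, hn⟩ := hfin
  induction n generalizing v with
  | zero => simp at hn
  | succ n ih =>
    by_cases h : ∃ j, ¬ π ∣ v j
    · exact ⟨v, h, hMv⟩
    · push Not at h
      choose w hw using h
      have hvw : v = π • w := funext hw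
      subst hvw
      rw [Matrix.mulVec_smul] at hMv
      refine ih (v := w) (fun h0 => hv (by simp [h0])) ((smul_eq_zero.1 hMv).resolve_left hπ0)
        (fun h0 => hi (by simp [h0])) fun hdvd => hn ?_
      rw [pow_succ']
      exact mul_dvd_mul_left _ hdvd

/-- A kernel vector, scaled so as not to vanish modulo `ζ - 1`, gives a polynomial with at most `n`
terms and roots `ζ ^ b i`. Modulo `ζ - 1` the characteristic is `p` and all `n` roots collapse to
`1`, which needs more than `n` terms. -/
theorem det_pow_ne_zero_of_isCyclotomicExtension {p : ℕ} [hp : Fact p.Prime] {K : Type*} [Field K]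
    [NumberField K] [IsCyclotomicExtension {p} ℚ K] {ζ : K} (hζ : IsPrimitiveRoot ζ p) {n : ℕ}
    {a b : Fin n → ℕ} (ha : Function.Injective a) (hb : Function.Injective b)
    (hap : ∀ i, a i < p) (hbp : ∀ i, b i < p) :
    (Matrix.of fun i j => ζ ^ (b i * a j)).det ≠ 0 := by
  intro hdet
  set z := hζ.toInteger with hz
  have hzp : IsPrimitiveRoot z p := hζ.toInteger_isPrimitiveRoot
  set M : Matrix (Fin n) (Fin n) (NumberField.RingOfIntegers K) :=
    Matrix.of fun i j => z ^ (b i * a j) with hM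
  have hMdet : M.det = 0 := by
    apply NumberField.RingOfIntegers.coe_injective
    rw [map_zero, ← hdet, RingHom.map_det]
    congr 1
  obtain ⟨v, hv, hMv⟩ := Matrix.exists_mulVec_eq_zero_iff.2 hMdet
  have hprime : Prime (z - 1) := hζ.zeta_sub_one_prime'
  obtain ⟨w, ⟨i₀, hi₀⟩, hMw⟩ :=
    exists_not_dvd_of_mulVec_eq_zero hprime.not_isUnit hprime.ne_zero M hv hMv
  set P : (NumberField.RingOfIntegers K)[X] := ∑ j, monomial (a j) (w j) with hP
  have hroot : ∀ i, P.eval (z ^ b i) = 0 := by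
    intro i
    have := congrFun hMw i
    simp only [Matrix.mulVec, dotProduct, hM, Matrix.of_apply, Pi.zero_apply] at this
    rw [← this, hP, eval_finsetSum]
    refine Finset.sum_congr rfl fun j _ => ?_
    rw [eval_monomial, pow_mul, mul_comm]
  have hinj : Function.Injective fun i => z ^ b i := fun i j h =>
    hb (hzp.pow_inj (hbp i) (hbp j) h)
  have hdvd : ∏ i, (X - C (z ^ b i)) ∣ P := by
    by_cases hP0 : P = 0
    · simp [hP0]
    · have h := (Multiset.prod_X_sub_C_dvd_iff_le_roots hP0
        (Finset.univ.val.map fun i => z ^ b i)).2 ((Multiset.le_iff_subset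
          (Multiset.Nodup.map hinj Finset.univ.nodup)).2 fun x hx => ?_)
      · rwa [Multiset.map_map] at h
      · obtain ⟨i, _, rfl⟩ := Multiset.mem_map.1 hx
        exact (mem_roots hP0).2 (hroot i)
  have hI : (Ideal.span {z - 1}).IsPrime := (Ideal.span_singleton_prime hprime.ne_zero).2 hprime
  let F := NumberField.RingOfIntegers K ⧸ Ideal.span {z - 1}
  let q : NumberField.RingOfIntegers K →+* F := Ideal.Quotient.mk _
  have hq : ∀ x, q x = 0 ↔ z - 1 ∣ x := fun x => by
    rw [Ideal.Quotient.eq_zero_iff_mem, Ideal.mem_span_singleton]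
  have hq1 : q z = 1 := by
    rw [← sub_eq_zero, ← map_one q, ← map_sub, hq]
  have hpF : ((p : ℕ) : F) = 0 := by
    rw [← map_natCast q, hq]
    exact hζ.toInteger_sub_one_dvd_prime'
  have : CharP F p := (CharP.charP_iff_prime_eq_zero hp.out).2 hpF
  have hcoeff : (P.map q).coeff (a i₀) = q (w i₀) := by
    simp only [coeff_map, hP, finsetSum_coeff, coeff_monomial, ha.eq_iff]
    simp
  have hsupp : (P.map q).support ⊆ Finset.univ.image a := by
    refine (support_map_subset _ _).trans fun k hk => ?_
    by_contra hne
    apply mem_support_iff.1 hk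
    simp only [hP, finsetSum_coeff, coeff_monomial]
    refine Finset.sum_eq_zero fun j _ => if_neg fun hj => hne ?_
    exact Finset.mem_image.2 ⟨j, Finset.mem_univ _, hj⟩
  have hne : P.map q ≠ 0 := by
    intro h0
    rw [h0, coeff_zero] at hcoeff
    exact hi₀ ((hq _).1 hcoeff.symm)
  have hdeg : (P.map q).natDegree < p := by
    obtain ⟨j, _, hj⟩ := Finset.mem_image.1 (hsupp (natDegree_mem_support_of_nonzero hne))
    exact hj ▸ hap j
  have hdvd' : (X - 1) ^ n ∣ P.map q := by
    have h := Polynomial.map_dvd q hdvd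
    simpa [Polynomial.map_prod, hq1] using h
  have hlt := lt_card_support_of_pow_X_sub_one_dvd p n hne hdeg hdvd'
  have hle := (Finset.card_le_card hsupp).trans Finset.card_image_le
  simp at hle
  omega

/-- **Chebotarev's theorem**: the minors of the Fourier matrix of prime order do not vanish. -/
theorem det_pow_ne_zero_of_isPrimitiveRoot {p : ℕ} [hp : Fact p.Prime] {ζ : ℂ}
    (hζ : IsPrimitiveRoot ζ p) {n : ℕ} {a b : Fin n → ℕ}
    (ha : Function.Injective a) (hb : Function.Injective b)
    (hap : ∀ i, a i < p) (hbp : ∀ i, b i < p) :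
    (Matrix.of fun i j => ζ ^ (b i * a j)).det ≠ 0 := by
  have : NeZero p := ⟨hp.out.ne_zero⟩
  have hcyc : IsCyclotomicExtension {p} ℚ (IntermediateField.adjoin ℚ {ζ}) :=
    (IntermediateField.isCyclotomicExtension_singleton_iff_eq_adjoin p ℚ ℂ _ hζ).2 rfl
  have hnf : NumberField (IntermediateField.adjoin ℚ {ζ}) :=
    IsCyclotomicExtension.numberField {p} ℚ _
  have hgen : IsPrimitiveRoot (IntermediateField.AdjoinSimple.gen ℚ ζ) p :=
    IsPrimitiveRoot.coe_submonoidClass_iff.1 hζ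
  intro h
  apply det_pow_ne_zero_of_isCyclotomicExtension hgen ha hb hap hbp
  apply (algebraMap (IntermediateField.adjoin ℚ {ζ}) ℂ).injective
  rw [map_zero, ← h, RingHom.map_det]
  congr 1

end ChebotarevMinors

/-! ### Runs of zeros and uncertainty principles -/

namespace FiniteSTFT

theorem neg_mem_indexRange {d : ℕ} {m : ℤ} {k : ZMod d} (h : k ∈ indexRange d (-m) m) :
    -k ∈ indexRange d (-m) m := by
  obtain ⟨i, ⟨h1, h2⟩, rfl⟩ := h
  exact ⟨-i, ⟨by linarith, by linarith⟩, by simp⟩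

variable {d : ℕ} [NeZero d]

/-- Take `a ∈ A`, `b ∈ B` at minimal forward distance: it exceeds `m`, and a point of `A` among the
`m` points after `a` would be closer to `b`. -/
theorem exists_gap_of_sub_notMem_indexRange {m : ℕ} {A B : Finset (ZMod d)} (hA : A.Nonempty)
    (hB : B.Nonempty) (h : ∀ a ∈ A, ∀ b ∈ B, b - a ∉ indexRange d (-m) m) :
    m < d ∧ ∃ a ∈ A, ∀ i ∈ Finset.Icc 1 m, a + (i : ZMod d) ∉ A ∧ a + (i : ZMod d) ∉ B := by
  obtain ⟨⟨a, b⟩, hab, hmin⟩ := Finset.exists_min_image (A ×ˢ B) (fun q => (q.2 - q.1).val)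
    (hA.product hB)
  obtain ⟨ha, hb⟩ := Finset.mem_product.1 hab
  have hlt : m < (b - a).val := by
    by_contra! hle
    exact h a ha b hb ⟨(b - a).val, ⟨by omega, by omega⟩, by simp⟩
  refine ⟨hlt.trans (ZMod.val_lt _), a, ha, fun i hi => ?_⟩
  rw [Finset.mem_Icc] at hi
  refine ⟨fun hiA => ?_, fun hiB => ?_⟩
  · have hval : (b - (a + i)).val = (b - a).val - i := by
      have : b - (a + i) = (((b - a).val - i : ℕ) : ZMod d) := by
        rw [Nat.cast_sub (by omega), ZMod.natCast_zmod_val]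
        ring
      rw [this, ZMod.val_natCast_of_lt]
      have := ZMod.val_lt (b - a)
      omega
    have := hmin (a + i, b) (Finset.mem_product.2 ⟨hiA, hb⟩)
    simp only [hval] at this
    omega
  · exact h a ha _ hiB ⟨i, ⟨by omega, by omega⟩, by simp⟩

/-- If the products `f j * conj (f (j - k))`, `|k| ≤ m`, do not determine `f` up to a global phase,
then `f` vanishes on two disjoint runs of `m` consecutive points. -/
theorem exists_gap_of_forall_ne_smul {m : ℕ} {f f' : ZMod d → ℂ}
    (h : ∀ k ∈ indexRange d (-m) m, ∀ j, f' j * conj (f' (j - k)) = f j * conj (f (j - k)))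
    (hne : ¬ ∃ γ : ℂ, ‖γ‖ = 1 ∧ f' = γ • f) :
    f ≠ 0 ∧ (∃ a : ZMod d, ∀ i ∈ Finset.Icc 1 m, f (a + (i : ZMod d)) = 0) ∧
      ({j | f j ≠ 0} : Finset (ZMod d)).card + 2 * m ≤ d := by
  have hnorm : ∀ j, ‖f' j‖ = ‖f j‖ := by
    intro j
    have := congrArg norm (h 0 ⟨0, ⟨by omega, by omega⟩, by simp⟩ j)
    simp only [sub_zero, norm_mul, RCLike.norm_conj] at this
    exact (mul_self_inj (norm_nonneg _) (norm_nonneg _)).1 this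
  have hf0 : f ≠ 0 := by
    rintro rfl
    refine hne ⟨1, by simp, funext fun j => ?_⟩
    simpa using hnorm j
  obtain ⟨j₀, hj₀⟩ := Function.ne_iff.1 hf0
  rw [Pi.zero_apply] at hj₀
  set γ := f' j₀ / f j₀ with hγ
  have hγ1 : ‖γ‖ = 1 := by rw [hγ, norm_div, hnorm, div_self (norm_ne_zero_iff.2 hj₀)]
  -- Known products carry the phase `γ` across steps of length at most `m`, so `A` and `B` are more
  -- than `m` apart in both directions.
  let A : Finset (ZMod d) := {j | f j ≠ 0 ∧ f' j = γ * f j}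
  let B : Finset (ZMod d) := {j | f j ≠ 0 ∧ f' j ≠ γ * f j}
  have hA : A.Nonempty := ⟨j₀, by simp [A, hγ, hj₀]⟩
  have hB : B.Nonempty := by
    by_contra hB
    rw [Finset.not_nonempty_iff_eq_empty, Finset.filter_eq_empty_iff] at hB
    refine hne ⟨γ, hγ1, funext fun j => ?_⟩
    by_cases hj : f j = 0
    · have := hnorm j
      rw [hj, norm_zero, norm_eq_zero] at this
      simp [hj, this]
    · by_contra hj'
      exact hB (Finset.mem_univ j) ⟨hj, hj'⟩
  have hAB : ∀ a ∈ A, ∀ b ∈ B, b - a ∉ indexRange d (-m) m := by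
    intro a ha b hb hk
    simp only [A, B, Finset.mem_filter, Finset.mem_univ, true_and] at ha hb
    have hab := h _ hk b
    rw [sub_sub_cancel, ha.2, map_mul, ← mul_assoc] at hab
    have h1 : f' b * conj γ = f b := mul_right_cancel₀ (by simpa using ha.1) hab
    apply hb.2
    rw [← h1, mul_left_comm, Complex.mul_conj', hγ1]
    simp
  have hBA : ∀ b ∈ B, ∀ a ∈ A, a - b ∉ indexRange d (-m) m := fun b hb a ha hk =>
    hAB a ha b hb (by simpa using neg_mem_indexRange hk)
  obtain ⟨hmd, a, ha, hagap⟩ := exists_gap_of_sub_notMem_indexRange hA hB hAB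
  obtain ⟨-, b, hb, hbgap⟩ := exists_gap_of_sub_notMem_indexRange hB hA hBA
  have hzero : ∀ j, j ∉ A → j ∉ B → f j = 0 := by
    intro j hjA hjB
    simp only [A, B, Finset.mem_filter, Finset.mem_univ, true_and] at hjA hjB
    tauto
  have ha0 : ∀ i ∈ Finset.Icc 1 m, f (a + (i : ZMod d)) = 0 := fun i hi =>
    hzero _ (hagap i hi).1 (hagap i hi).2
  have hb0 : ∀ i ∈ Finset.Icc 1 m, f (b + (i : ZMod d)) = 0 := fun i hi =>
    hzero _ (hbgap i hi).2 (hbgap i hi).1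
  refine ⟨hf0, ⟨a, ha0⟩, ?_⟩
  have hcard : ∀ c : ZMod d, ((Finset.Icc 1 m).image fun i : ℕ => c + (i : ZMod d)).card = m := by
    intro c
    rw [Finset.card_image_of_injOn, Nat.card_Icc, Nat.add_sub_cancel]
    intro i hi j hj hij
    simp only [Finset.coe_Icc, Set.mem_Icc] at hi hj
    have := congrArg ZMod.val (add_left_cancel hij)
    rwa [ZMod.val_natCast_of_lt (by omega), ZMod.val_natCast_of_lt (by omega)] at this
  have hdisj : Disjoint ((Finset.Icc 1 m).image fun i : ℕ => a + (i : ZMod d))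
      ((Finset.Icc 1 m).image fun i : ℕ => b + (i : ZMod d)) := by
    rw [Finset.disjoint_left]
    intro x hx hy
    obtain ⟨i, hi, rfl⟩ := Finset.mem_image.1 hx
    obtain ⟨j, hj, hij⟩ := Finset.mem_image.1 hy
    rw [Finset.mem_Icc] at hi hj
    refine hAB a ha b hb ⟨(i : ℤ) - j, ⟨by omega, by omega⟩, ?_⟩
    push_cast
    linear_combination -hij
  have hsub : ((Finset.Icc 1 m).image fun i : ℕ => a + (i : ZMod d)) ∪
      ((Finset.Icc 1 m).image fun i : ℕ => b + (i : ZMod d)) ⊆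
      ({j | ¬ f j ≠ 0} : Finset (ZMod d)) := by
    intro x hx
    simp only [Finset.mem_union, Finset.mem_image] at hx
    simp only [Finset.mem_filter, Finset.mem_univ, true_and, not_not]
    rcases hx with ⟨i, hi, rfl⟩ | ⟨i, hi, rfl⟩
    exacts [ha0 i hi, hb0 i hi]
  have h1 := Finset.card_le_card hsub
  rw [Finset.card_union_of_disjoint hdisj, hcard, hcard] at h1
  have h2 := Finset.card_filter_add_card_filter_not (s := (Finset.univ : Finset (ZMod d)))
    (fun j => f j ≠ 0)
  rw [Finset.card_univ, ZMod.card] at h2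
  omega

/-- A signal supported on at most `m` points whose Fourier transform vanishes at `m` consecutive
points is zero. -/
theorem eq_zero_of_dft_eq_zero_on_gap {m : ℕ} {f : ZMod d → ℂ}
    (hcard : ({j | f j ≠ 0} : Finset (ZMod d)).card ≤ m) {c : ZMod d}
    (hc : ∀ i ∈ Finset.Icc 1 m, 𝓕 f (c + (i : ZMod d)) = 0) : f = 0 := by
  classical
  by_contra hf
  obtain ⟨j₀, hj₀⟩ := Function.ne_iff.1 hf
  rw [Pi.zero_apply] at hj₀
  set S : Finset (ZMod d) := {j | f j ≠ 0} with hS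
  let e : ZMod d → ℂ := fun j => ZMod.stdAddChar (-j)
  have he : Function.Injective e := fun x y hxy =>
    neg_injective (ZMod.injective_stdAddChar hxy)
  have hpow : ∀ i < m, ∑ j, f j * ZMod.stdAddChar (-(j * (c + 1))) * e j ^ i = 0 := by
    intro i hi
    rw [← hc (i + 1) (Finset.mem_Icc.2 ⟨by omega, by omega⟩), dft_apply]
    refine Finset.sum_congr rfl fun j _ => ?_
    rw [smul_eq_mul, show -(j * (c + ((i + 1 : ℕ) : ZMod d))) = -(j * (c + 1)) + i • (-j) by
      rw [nsmul_eq_mul]; push_cast; ring, AddChar.map_add_eq_mul, AddChar.map_nsmul_eq_pow]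
    ring
  have hpoly : ∀ q : Polynomial ℂ, q.natDegree < m →
      ∑ j, f j * ZMod.stdAddChar (-(j * (c + 1))) * q.eval (e j) = 0 := by
    intro q hq
    simp only [Polynomial.eval_eq_sum_range' hq, Finset.mul_sum]
    rw [Finset.sum_comm]
    refine Finset.sum_eq_zero fun i hi => ?_
    rw [← mul_zero (q.coeff i), ← hpow i (Finset.mem_range.1 hi), Finset.mul_sum]
    refine Finset.sum_congr rfl fun j _ => ?_
    ring
  have hj₀S : j₀ ∈ S := by simpa [hS] using hj₀
  -- Testing against this polynomial isolates the term at `j₀`.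
  have hdeg : (∏ j ∈ S.erase j₀, (Polynomial.X - Polynomial.C (e j))).natDegree < m := by
    rw [Polynomial.natDegree_finsetProd_X_sub_C_eq_card, Finset.card_erase_of_mem hj₀S]
    have := Finset.card_pos.2 ⟨j₀, hj₀S⟩
    omega
  have hsum := hpoly _ hdeg
  rw [Finset.sum_eq_single j₀] at hsum
  · refine absurd hsum (mul_ne_zero (mul_ne_zero hj₀ (stdAddChar_ne_zero _)) ?_)
    rw [Polynomial.eval_prod, Finset.prod_ne_zero_iff]
    intro j hj
    simpa [sub_eq_zero] using fun h => (Finset.mem_erase.1 hj).1 (he h).symm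
  · intro j _ hj
    by_cases hfj : f j = 0
    · simp [hfj]
    · rw [Polynomial.eval_prod, Finset.prod_eq_zero (i := j), mul_zero]
      · exact Finset.mem_erase.2 ⟨hj, by simpa [hS] using hfj⟩
      · simp
  · simp

theorem isPrimitiveRoot_stdAddChar_neg_one :
    IsPrimitiveRoot (ZMod.stdAddChar (-1 : ZMod d) : ℂ) d := by
  have h : ∀ k : ℕ, (ZMod.stdAddChar (-1 : ZMod d) : ℂ) ^ k = ZMod.stdAddChar (-(k : ZMod d)) := by
    intro k
    rw [← AddChar.map_nsmul_eq_pow]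
    simp
  refine (IsPrimitiveRoot.iff_def _ _).2 ⟨by simp [h], fun k hk => ?_⟩
  rw [h, ← AddChar.map_zero_eq_one (ZMod.stdAddChar (N := d)),
    ZMod.injective_stdAddChar.eq_iff, neg_eq_zero] at hk
  exact (ZMod.natCast_eq_zero_iff _ _).1 hk

/-- The uncertainty principle on groups of prime order. -/
theorem lt_card_support_add_card_support_dft (hd : d.Prime) {f : ZMod d → ℂ} (hf : f ≠ 0) :
    d < ({j | f j ≠ 0} : Finset (ZMod d)).card + ({j | 𝓕 f j ≠ 0} : Finset (ZMod d)).card := by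
  classical
  have : Fact d.Prime := ⟨hd⟩
  by_contra! hle
  set A : Finset (ZMod d) := {j | f j ≠ 0} with hA
  have hZ := Finset.card_filter_add_card_filter_not (s := (Finset.univ : Finset (ZMod d)))
    (fun j => 𝓕 f j ≠ 0)
  rw [Finset.card_univ, ZMod.card] at hZ
  -- Were the bound false, `f̂` would have enough zeros to pick a square Fourier minor that
  -- annihilates `f` on its support.
  obtain ⟨B, hB, hBcard⟩ := Finset.exists_subset_card_eq
    (show A.card ≤ ({j | ¬ 𝓕 f j ≠ 0} : Finset (ZMod d)).card by omega)
  let a : Fin A.card → ZMod d := fun i => A.equivFin.symm i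
  let b : Fin A.card → ZMod d := fun i => (B.equivFinOfCardEq hBcard).symm i
  have ha : Function.Injective a := Subtype.val_injective.comp (Equiv.injective _)
  have hb : Function.Injective b := Subtype.val_injective.comp (Equiv.injective _)
  have hdet := det_pow_ne_zero_of_isPrimitiveRoot (isPrimitiveRoot_stdAddChar_neg_one (d := d))
    ((ZMod.val_injective d).comp ha) ((ZMod.val_injective d).comp hb)
    (fun i => ZMod.val_lt _) (fun i => ZMod.val_lt _)
  have hker : (Matrix.of fun i j => (ZMod.stdAddChar (-1 : ZMod d) : ℂ) ^
      ((ZMod.val ∘ b) i * (ZMod.val ∘ a) j)).mulVec (f ∘ a) = 0 := by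
    ext i
    have hbi : 𝓕 f (b i) = 0 := by
      simpa using hB ((B.equivFinOfCardEq hBcard).symm i).2
    rw [Matrix.mulVec, dotProduct, Pi.zero_apply, ← hbi, dft_apply, ← Finset.sum_subset (Finset.subset_univ A),
      ← Finset.sum_coe_sort A, ← Equiv.sum_comp A.equivFin.symm]
    · refine Finset.sum_congr rfl fun j _ => ?_
      rw [Matrix.of_apply, ← AddChar.map_nsmul_eq_pow, smul_eq_mul]
      refine congrArg₂ _ (congrArg _ ?_) rfl
      simp [a, b, mul_comm]
    · intro j _ hj
      simp only [hA, Finset.mem_filter, Finset.mem_univ, true_and, not_not] at hj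
      simp [hj]
  have hfa := Matrix.eq_zero_of_mulVec_eq_zero hdet hker
  obtain ⟨j, hj⟩ := Function.ne_iff.1 hf
  have hjA : j ∈ A := by simpa [hA] using hj
  apply hj
  simpa [a] using congrFun hfa (A.equivFin ⟨j, hjA⟩)

end FiniteSTFT

open FiniteSTFT in
theorem mainTheorem3 (d : ℕ) [NeZero d] (hd : 2 ≤ d) (m : ℕ) (hm : FiniteSTFT.mStar d < (m : ℝ))
    (g : ZMod d → ℂ)
    (hg : FiniteSTFT.indexRange d (-(m : ℤ)) (m : ℤ) ×ˢ (Set.univ : Set (ZMod d)) ⊆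
      Function.support (FiniteSTFT.stft g g)) :
    FiniteSTFT.StrongTwoWindowPhaseRetrieval g (ZMod.dft g) := by
  intro f
  by_contra! hcon
  obtain ⟨h₁, h₂⟩ := hcon
  simp only [PhaseRetrievable, not_forall] at h₁ h₂
  obtain ⟨f₁, hf₁, hne₁⟩ := h₁
  obtain ⟨f₂, hf₂, hne₂⟩ := h₂
  obtain ⟨hf0, -, hcard⟩ := exists_gap_of_forall_ne_smul (m := m) (f := f) (f' := f₁)
    (fun k hk j => mul_conj_eq_of_stft_self_eq (fun l =>
      stft_self_eq_of_norm_stft_eq hf₁ (hg ⟨hk, Set.mem_univ l⟩)) j) hne₁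
  have hd0 : (d : ℂ) ≠ 0 := Nat.cast_ne_zero.2 (NeZero.ne d)
  have hne₂' : ¬ ∃ γ : ℂ, ‖γ‖ = 1 ∧ ZMod.dft f₂ = γ • ZMod.dft f := by
    rintro ⟨γ, hγ, h⟩
    exact hne₂ ⟨γ, hγ, ZMod.dft.injective (by rw [h, _root_.map_smul])⟩
  obtain ⟨-, ⟨c, hc⟩, hcard'⟩ := exists_gap_of_forall_ne_smul (m := m) (f := ZMod.dft f)
    (f' := ZMod.dft f₂) (fun k hk j => mul_conj_eq_of_stft_self_eq (fun l => by
      -- The rotation is used twice, for the signals and for the window, so the nonvanishing is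
      -- needed at `(-k, -l)`.
      rw [stft_dft_self, stft_dft_self, stft_self_eq_of_norm_stft_eq (p := (-l, k)) hf₂]
      rw [stft_dft_self]
      exact mul_ne_zero (mul_ne_zero hd0 (stdAddChar_ne_zero _)) (hg ⟨neg_mem_indexRange hk, Set.mem_univ _⟩)) j) hne₂'
  rw [mStar] at hm
  split_ifs at hm with hp
  · have hlt := lt_card_support_add_card_support_dft hp hf0
    have : d < 4 * m + 1 := by
      have : (d : ℝ) < 4 * m + 1 := by linarith
      exact_mod_cast this
    omega
  · have : d < 3 * m + 1 := by
      have : (d : ℝ) < 3 * m + 1 := by linarith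
      exact_mod_cast this
    exact hf0 (eq_zero_of_dft_eq_zero_on_gap (by omega) hc)
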